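/- Let $G$ be a set (of arbitrary cardinality), and let $\mathcal{P}_{\mathrm{fin}}(G)$ be the set of finite subsets of $G$, ordered by inclusion. For a frame $A$, a function $f : G \to A$ and an upward-closed subset $U \subseteq \mathcal{P}_{\mathrm{fin}}(G)$, put $$f(U) = \bigvee_{F \in U} \ \bigwedge_{g \in F} f(g) \in A ,$$ where the empty meet is the top element. A *relation* is a formal inequality $U \le V$ between two upward-closed subsets $U, V$ of $\mathcal{P}_{\mathrm{fin}}(G)$; it is *satisfied* by $f$ if $f(U) \le f(V)$. A frame $A$ is *presented* by the generators $G$ and a set $R$ of relations if there is a function $i : G \to A$ that satisfies all relations in $R$ and is universal with this property: for every frame $B$ and every function $f : G \to B$ that satisfies all relations in $R$ there is a unique frame homomorphism $h : A \to B$ with $h \circ i = f$. **Corollary (Heckmann).** Let $L$ be a locale whose frame of opens $\mathcal{O}(L)$ is presented by a set $G$ of generators and a countable (finite or countably infinite) set $R$ of relations. Then $L$ is spatial, that is, $L$ is isomorphic to the locale of open sets of a topological space. -/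

import Mathlib

universe u v

/-- A frame relation over a set `G` of generators is a formal inequality `U ≤ V` between two
upward-closed subsets `U`, `V` of the poset `P_fin(G)` of finite subsets of `G` (ordered by
inclusion); it is recorded as the pair `(U, V)`. An upward-closed `U` stands for the element
`⋁_{F ∈ U} ⋀_{g ∈ F} g` of the free frame on `G`. -/
abbrev FrameRelation (G : Type v) : Type v := UpperSet (Finset G) × UpperSet (Finset G)

/-- The value `⋁_{F ∈ U} ⋀_{g ∈ F} f g` in a frame `A` of an upward-closed subset `U` of
`P_fin(G)`, under an interpretation `f` of the generators. The empty meet is the top element. -/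
def UpperSet.frameEval {G : Type v} {A : Type u} [Order.Frame A] (f : G → A)
    (U : UpperSet (Finset G)) : A :=
  ⨆ F ∈ U, F.inf f

/-- The interpretation `f` of the generators in the frame `A` satisfies all relations in `R`. -/
def SatisfiesFrameRelations {G : Type v} {A : Type u} [Order.Frame A]
    (R : Set (FrameRelation G)) (f : G → A) : Prop :=
  ∀ r ∈ R, r.1.frameEval f ≤ r.2.frameEval f

/-- The frame `A`, with the interpretation `i` of the generators, is presented by the generators
`G` and the relations `R`: `i` satisfies the relations and is universal among the interpretations
that do. (Frames of size `max u v` suffice as test objects, since `A` and the frame constructed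
from `G` and `R` both have copies there.) -/
structure IsFramePresentation {G : Type v} {A : Type u} [Order.Frame A]
    (R : Set (FrameRelation G)) (i : G → A) : Prop where
  satisfies : SatisfiesFrameRelations R i
  existsUnique_lift : ∀ (B : Type (max u v)) [Order.Frame B] (f : G → B),
    SatisfiesFrameRelations R f → ∃! h : FrameHom A B, ∀ g : G, h (i g) = f g

/-- A locale is spatial if it is isomorphic to the locale of open sets of a topological space. -/
def Locale.IsSpatial (L : Locale.{u}) : Prop :=
  ∃ X : TopCat.{u}, Nonempty (L ≅ topToLocale.obj X)

open CategoryTheory TopologicalSpace Order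

/-! This is a Rasiowa–Sikorski argument. If `a ≰ b`, some finite meet of generators lies below `a`
but not below `b` (`isSpanned`). Grow its index set along a chain of finite sets, keeping the meet
not below `b`, while each relation is treated infinitely often (`exists_refinement`). The union of
the chain is a model (`exists_model`), since every instance of a left side is finite and appears at
some stage. The resulting point lies in `a` but not in `b`. -/

/-- A frame homomorphism commutes with the evaluation of upper sets of finite sets of
generators. -/
theorem FrameHom.map_frameEval {G : Type*} {A B : Type*} [Frame A] [Frame B] (h : FrameHom A B)
    (f : G → A) (U : UpperSet (Finset G)) :
    h (U.frameEval f) = U.frameEval fun g => h (f g) := by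
  simp only [UpperSet.frameEval, map_iSup, map_finset_inf]
  rfl

/-- The element `b` is a join of finite meets of values of `j`. -/
def IsSpanned {G : Type*} {B : Type*} [Frame B] (j : G → B) (b : B) : Prop :=
  ∀ c, (∀ F : Finset G, F.inf j ≤ b → F.inf j ≤ c) → b ≤ c

namespace IsSpanned

variable {G : Type*} {B : Type*} [Frame B] {j : G → B}

theorem of_generator (g : G) : IsSpanned j (j g) := fun c h => by
  simpa using h {g}

theorem top : IsSpanned j ⊤ := fun c h => by
  simpa using h ∅

theorem sSup {s : Set B} (hs : ∀ x ∈ s, IsSpanned j x) : IsSpanned j (sSup s) := fun c h =>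
  sSup_le fun x hx => hs x hx c fun F hF => h F (hF.trans (le_sSup hx))

theorem inf {x y : B} (hx : IsSpanned j x) (hy : IsSpanned j y) : IsSpanned j (x ⊓ y) := by
  classical
  intro c h
  -- Heyting implication turns the claim into a bound on one factor at a time.
  rw [← le_himp_iff]
  refine hx _ fun F hF => ?_
  rw [le_himp_comm]
  refine hy _ fun F' hF' => ?_
  rw [le_himp_iff, inf_comm, ← Finset.inf_union]
  exact h _ (by rw [Finset.inf_union]; exact inf_le_inf hF hF')

end IsSpanned

/-- The subframe generated by the values of `j`. -/
def SpannedFrame {G : Type*} {B : Type*} [Frame B] (j : G → B) : Type _ :=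
  {b : B // IsSpanned j b}

namespace SpannedFrame

variable {G : Type*} {B : Type*} [Frame B] (j : G → B)

instance : PartialOrder (SpannedFrame j) := Subtype.partialOrder _

instance : SupSet (SpannedFrame j) where
  sSup s := ⟨sSup (Subtype.val '' s), IsSpanned.sSup (by rintro _ ⟨x, -, rfl⟩; exact x.2)⟩

instance : CompleteLattice (SpannedFrame j) where
  __ := completeLatticeOfSup (SpannedFrame j) fun s =>
    ⟨fun x hx => le_sSup (a := x.1) ⟨x, hx, rfl⟩,
      fun y hy => sSup_le (a := y.1) (by rintro _ ⟨x, hx, rfl⟩; exact hy hx)⟩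
  top := ⟨⊤, IsSpanned.top⟩
  le_top x := le_top (a := x.1)
  inf x y := ⟨x.1 ⊓ y.1, x.2.inf y.2⟩
  inf_le_left x y := inf_le_left (a := x.1) (b := y.1)
  inf_le_right x y := inf_le_right (a := x.1) (b := y.1)
  le_inf x y z hy hz := show x.1 ≤ y.1 ⊓ z.1 from le_inf hy hz

instance : Frame (SpannedFrame j) := Frame.ofMinimalAxioms
  { inf_sSup_le_iSup_inf := fun a s => by
      change a.1 ⊓ sSup (Subtype.val '' s) ≤ (⨆ b ∈ s, a ⊓ b : SpannedFrame j).1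
      rw [inf_sSup_eq]
      refine iSup₂_le ?_
      rintro _ ⟨b, hb, rfl⟩
      exact le_iSup₂ (f := fun (b : SpannedFrame j) (_ : b ∈ s) => a ⊓ b) b hb }

/-- The inclusion of the subframe generated by the values of `j`. -/
def incl : FrameHom (SpannedFrame j) B where
  toFun := Subtype.val
  map_inf' _ _ := rfl
  map_top' := rfl
  map_sSup' _ := rfl

/-- The generators, as elements of the subframe generated by them. -/
def generator (g : G) : SpannedFrame j := ⟨j g, IsSpanned.of_generator g⟩

theorem satisfies {R : Set (FrameRelation G)} (hj : SatisfiesFrameRelations R j) :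
    SatisfiesFrameRelations R (generator j) := fun r hr => by
  change incl j (r.1.frameEval (generator j)) ≤ incl j (r.2.frameEval (generator j))
  rw [FrameHom.map_frameEval, FrameHom.map_frameEval]
  exact hj r hr

end SpannedFrame

/-- A frame as the frame of constant functions on a one-point type of another universe. -/
def FrameHom.punitConst (A : Type*) [Frame A] : FrameHom A (PUnit → A) where
  toFun a _ := a
  map_inf' _ _ := rfl
  map_top' := rfl
  map_sSup' s := by
    funext x
    rw [sSup_image]
    simp [sSup_eq_iSup]

/-- Evaluation at the point of a one-point type, as a frame homomorphism. -/
def FrameHom.punitEval (A : Type*) [Frame A] : FrameHom (PUnit → A) A where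
  toFun a := a PUnit.unit
  map_inf' _ _ := rfl
  map_top' := rfl
  map_sSup' s := by
    simp [sSup_apply, sSup_image, iSup_subtype]

theorem SatisfiesFrameRelations.map {G : Type*} {A B : Type*} [Frame A] [Frame B]
    {R : Set (FrameRelation G)} {f : G → A} (hf : SatisfiesFrameRelations R f)
    (h : FrameHom A B) : SatisfiesFrameRelations R fun g => h (f g) := fun r hr => by
  rw [← FrameHom.map_frameEval, ← FrameHom.map_frameEval]
  exact OrderHomClass.mono h (hf r hr)

namespace IsFramePresentation

variable {G : Type v} {A : Type u} [Frame A] {R : Set (FrameRelation G)} {i : G → A}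

/-- The generators of a presentation generate the frame. -/
theorem isSpanned (hi : IsFramePresentation R i) (a : A) : IsSpanned i a := by
  -- Test frames live in `Type (max u v)`, so `A` is replaced by a copy there.
  let c : FrameHom A (PUnit.{v + 1} → A) := FrameHom.punitConst A
  let j : G → PUnit.{v + 1} → A := fun g => c (i g)
  have hj : SatisfiesFrameRelations R j := hi.satisfies.map c
  obtain ⟨k, hk, -⟩ := hi.existsUnique_lift _ _ (SpannedFrame.satisfies j hj)
  -- Both maps lift `j`; uniqueness makes `c` factor through the spanned subframe.
  have hck : (SpannedFrame.incl j).comp k = c :=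
    (hi.existsUnique_lift _ j hj).unique
      (fun g => congrArg (SpannedFrame.incl j) (hk g)) fun g => rfl
  have ha : IsSpanned j (c a) := by
    rw [← hck]
    exact (k a).2
  have hF : ∀ F : Finset G, F.inf j = c (F.inf i) := fun F => (map_finset_inf c F i).symm
  intro b hb
  refine ha (c b) (fun F hFa => ?_) PUnit.unit
  rw [hF] at hFa ⊢
  exact OrderHomClass.mono c (hb F (hFa PUnit.unit))

/-- Models of the relations in the truth values extend to points of the presented frame. -/
theorem exists_point (hi : IsFramePresentation R i) (p : G → Prop)
    (hp : SatisfiesFrameRelations R p) : ∃ h : FrameHom A Prop, ∀ g, h (i g) = p g := by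
  obtain ⟨k, hk, -⟩ := hi.existsUnique_lift (PUnit.{max u v + 1} → Prop) _
    (hp.map (FrameHom.punitConst Prop))
  exact ⟨(FrameHom.punitEval Prop).comp k, fun g => congrFun (hk g) PUnit.unit⟩

end IsFramePresentation

theorem finset_inf_prop_iff {G : Type*} (p : G → Prop) (F : Finset G) :
    F.inf p ↔ ∀ g ∈ F, p g := by
  classical
  induction F using Finset.induction_on with
  | empty => simp
  | insert a s _ ih => simp [ih]

theorem frameEval_prop_iff {G : Type*} (p : G → Prop) (U : UpperSet (Finset G)) :
    U.frameEval p ↔ ∃ F ∈ U, ∀ g ∈ F, p g := by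
  simp [UpperSet.frameEval, finset_inf_prop_iff]

/-- If a finite meet of generators lies below the left side of a valid relation but not below
`b`, it can be refined to one that witnesses the right side and still does not lie below `b`. -/
theorem exists_refinement {G A : Type*} [Frame A] {i : G → A} {r : FrameRelation G}
    (hr : r.1.frameEval i ≤ r.2.frameEval i) {b : A} {F : Finset G} (hF : ¬ F.inf i ≤ b) :
    ∃ F', F ⊆ F' ∧ ¬ F'.inf i ≤ b ∧ (F ∈ r.1 → F' ∈ r.2) := by
  classical
  by_cases hFr : F ∈ r.1
  · by_contra! hcon
    have hle : F.inf i ≤ r.2.frameEval i :=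
      (le_iSup₂ (f := fun (F : Finset G) (_ : F ∈ r.1) => F.inf i) F hFr).trans hr
    apply hF
    -- By distributivity `F.inf i` is the join of the meets over `F ∪ K` with `K ∈ r.2`, so these
    -- cannot all lie below `b`.
    rw [← inf_eq_left.mpr hle, UpperSet.frameEval, inf_iSup₂_eq]
    refine iSup₂_le fun K hK => ?_
    rw [← Finset.inf_union]
    by_contra hb
    exact (hcon (F ∪ K) Finset.subset_union_left hb).2
      (r.2.upper Finset.subset_union_right hK)
  · exact ⟨F, subset_rfl, hF, fun h => absurd h hFr⟩

/-- If countably many relations hold for `i`, and a finite meet of values of `i` does not lie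
below `b`, then there is a model of the relations that contains the finite set, none of whose
finite subsets has its meet below `b`. -/
theorem exists_model {G A : Type*} [Frame A] {R : Set (FrameRelation G)} (hR : R.Countable)
    {i : G → A} (hi : SatisfiesFrameRelations R i) {b : A} {F₀ : Finset G}
    (hF₀ : ¬ F₀.inf i ≤ b) :
    ∃ p : G → Prop, SatisfiesFrameRelations R p ∧ (∀ g ∈ F₀, p g) ∧
      ∀ F : Finset G, (∀ g ∈ F, p g) → ¬ F.inf i ≤ b := by
  classical
  rcases R.eq_empty_or_nonempty with rfl | hne
  · exact ⟨(· ∈ F₀), by simp [SatisfiesFrameRelations], fun g hg => hg, fun F hF hb =>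
      hF₀ ((Finset.inf_mono hF).trans hb)⟩
  obtain ⟨e, rfl⟩ := hR.exists_eq_range hne
  -- Stage `n` treats relation `n.unpair.1`, so each relation recurs arbitrarily late.
  have hstep : ∀ (n : ℕ) (F : {F : Finset G // ¬ F.inf i ≤ b}),
      ∃ F' : {F : Finset G // ¬ F.inf i ≤ b},
        F.1 ⊆ F'.1 ∧ (F.1 ∈ (e n.unpair.1).1 → F'.1 ∈ (e n.unpair.1).2) := fun n F => by
    obtain ⟨F', h₁, h₂, h₃⟩ := exists_refinement (hi (e n.unpair.1) ⟨_, rfl⟩) F.2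
    exact ⟨⟨F', h₂⟩, h₁, h₃⟩
  choose next hsub hnext using hstep
  let S : ℕ → {F : Finset G // ¬ F.inf i ≤ b} := fun n => Nat.rec ⟨F₀, hF₀⟩ next n
  have hmono : Monotone fun n => (S n).1 := monotone_nat_of_le_succ fun n => hsub n (S n)
  have hfin : ∀ F : Finset G, (∀ g ∈ F, ∃ n, g ∈ (S n).1) → ∃ n, F ⊆ (S n).1 := fun F hF => by
    choose! n hn using hF
    exact ⟨F.sup n, fun g hg => hmono (Finset.le_sup hg) (hn g hg)⟩
  refine ⟨fun g => ∃ n, g ∈ (S n).1, ?_, fun g hg => ⟨0, hg⟩, fun F hF hb => ?_⟩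
  · rintro _ ⟨m, rfl⟩ hU
    rw [frameEval_prop_iff] at hU ⊢
    obtain ⟨F, hFU, hF⟩ := hU
    obtain ⟨n, hn⟩ := hfin F hF
    -- Stage `Nat.pair m n ≥ n` treats relation `m` and already contains `F`.
    refine ⟨(S (Nat.pair m n + 1)).1, ?_, fun g hg => ⟨Nat.pair m n + 1, hg⟩⟩
    have := hnext (Nat.pair m n) (S (Nat.pair m n))
    rw [Nat.unpair_pair] at this
    exact this ((e m).1.upper (hn.trans (hmono (Nat.right_le_pair m n))) hFU)
  · obtain ⟨n, hn⟩ := hfin F hF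
    exact (S n).2 ((Finset.inf_mono hn).trans hb)

/-- A countably presented frame has enough points. -/
theorem IsFramePresentation.exists_point_separating {G : Type v} {A : Type u} [Frame A]
    {R : Set (FrameRelation G)} {i : G → A} (hi : IsFramePresentation R i) (hR : R.Countable)
    {a b : A} (hab : ¬ a ≤ b) : ∃ h : FrameHom A Prop, h a ∧ ¬ h b := by
  obtain ⟨F₀, hF₀a, hF₀b⟩ : ∃ F : Finset G, F.inf i ≤ a ∧ ¬ F.inf i ≤ b := by
    by_contra! hcon
    exact hab (hi.isSpanned a b hcon)
  obtain ⟨p, hpR, hpF₀, hpb⟩ := exists_model hR hi.satisfies hF₀b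
  obtain ⟨h, hh⟩ := hi.exists_point p hpR
  have hF : ∀ F : Finset G, h (F.inf i) ↔ ∀ g ∈ F, p g := fun F => by
    rw [map_finset_inf, finset_inf_prop_iff]
    simp [hh]
  refine ⟨h, OrderHomClass.mono h hF₀a ((hF F₀).2 hpF₀), fun hb => ?_⟩
  -- The point preserves this join, so containing `b` would force it to contain a finite meet below
  -- `b`.
  have hle : b ≤ sSup {x | ∃ F : Finset G, F.inf i ≤ b ∧ x = F.inf i} :=
    hi.isSpanned b _ fun F hFb => le_sSup ⟨F, hFb, rfl⟩
  have hsup := OrderHomClass.mono h hle hb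
  rw [map_sSup] at hsup
  obtain ⟨_, ⟨_, ⟨F, hFb, rfl⟩, rfl⟩, hpF⟩ := hsup
  exact hpb F ((hF F).1 hpF) hFb

/-- A locale with enough points is spatial. -/
theorem Locale.isSpatial_of_enough_points (L : Locale.{u})
    (h : ∀ a b : L, ¬ a ≤ b → ∃ p : FrameHom L Prop, p a ∧ ¬ p b) : L.IsSpatial := by
  have hle : ∀ {a b : L}, counitAppCont L a ≤ counitAppCont L b ↔ a ≤ b := fun {a b} => by
    refine ⟨fun hab => ?_, fun hab => OrderHomClass.mono (counitAppCont L) hab⟩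
    by_contra hcon
    obtain ⟨p, hpa, hpb⟩ := h a b hcon
    exact hpb (hab (show p ∈ counitAppCont L a from hpa))
  let e : L ≃o Opens (PT L) :=
    RelIso.ofSurjective (OrderEmbedding.ofMapLEIff (counitAppCont L) fun _ _ => hle)
      fun U => by
        obtain ⟨a, ha⟩ := U.2
        exact ⟨a, Opens.ext ha⟩
  exact ⟨TopCat.of (PT L), ⟨(Frm.Iso.mk (α := L.unop) (β := Frm.of (Opens (PT L))) e).symm.op⟩⟩

theorem mainTheorem10 (L : Locale.{u}) (G : Type v) (R : Set (FrameRelation G))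
    (hR : R.Countable) (i : G → L) (hi : IsFramePresentation R i) :
    L.IsSpatial :=
  L.isSpatial_of_enough_points fun _ _ hab => hi.exists_point_separating hR hab
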